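/- Let $n\ge 3$ be an integer and let $k\ge 3$ be an odd integer. Let $H=\mathbb{Z}^n$ with basis $x_1,\dots,x_n$ and dual basis $x_1^*,\dots,x_n^*$ of $H^*$, let $\mathcal{L}_n=\bigoplus_{m\ge 1}\mathcal{L}_n(m)$ be the free Lie algebra over $\mathbb{Z}$ on $x_1,\dots,x_n$, graded by weight, and let $\iota_m:\mathcal{L}_n(m)\to H^{\otimes m}$ be the degree $m$ part of the natural map of $\mathcal{L}_n$ into the tensor algebra of $H$. Identify the group of degree $k$ derivations of $\mathcal{L}_n$ with $\mathrm{Hom}(H,\mathcal{L}_n(k+1))=H^*\otimes_{\mathbb{Z}}\mathcal{L}_n(k+1)$. Let $\mathfrak{p}_n(k)\subset H^*\otimes_{\mathbb{Z}}\mathcal{L}_n(k+1)$ be the subgroup generated by the elements $x_i^*\otimes[x_{j_1},\dots,x_{j_k},x_i]$ (left-normed brackets) for $1\le i,j_1,\dots,j_k\le n$, and let $$\mathfrak{b}_n(k)=\mathfrak{p}_n(k)\cap\Big\{\sum_{i=1}^n x_i^*\otimes C_i \;\Big|\; C_i\in\mathcal{L}_n(k+1),\ \sum_{i=1}^n C_i=0\Big\}$$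 be the group of special derivations of degree $k$. Let the Morita trace $\mathrm{MT}_k:H^*\otimes_{\mathbb{Z}}\mathcal{L}_n(k+1)\to S^kH$ be the composition of $\mathrm{id}\otimes\iota_{k+1}$, the contraction $H^*\otimes H^{\otimes(k+1)}\to H^{\otimes k}$, $f\otimes a_1\otimes\cdots\otimes a_{k+1}\mapsto f(a_1)\,a_2\otimes\cdots\otimes a_{k+1}$, the projection of $H^{\otimes k}$ onto its coinvariants under cyclic permutations of the factors, and the projection from these onto the symmetric power $S^kH$. Let $\mathrm{MT}_k^B$ be the restriction of $\mathrm{MT}_k$ to $\mathfrak{b}_n(k)$. Then $\mathrm{Im}(\mathrm{MT}_k^B)$ is a free abelian group of finite rank, and $$\mathrm{rank}_{\mathbb{Z}}\big(\mathrm{Im}(\mathrm{MT}_k^B)\big)=\binom{n+k-1}{k}-\frac{n(n+1)}{2}.$$ -/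

import Mathlib

open scoped TensorProduct

noncomputable section

namespace SpecialDer

/-- `H = Rⁿ`, with its standard basis `x_1, …, x_n`. All constructions are written over a
commutative ring `R`; the objects of interest are those over `R = ℤ`. -/
abbrev H (R : Type) [CommRing R] (n : ℕ) : Type := Fin n → R

/-- The basis element `x_i` of `H`. -/
def x (R : Type) [CommRing R] {n : ℕ} (i : Fin n) : H R n := Pi.single i 1

/-- The element `x_i^*` of the basis of `H^*` dual to `x_1, …, x_n`. -/
def xDual (R : Type) [CommRing R] {n : ℕ} (i : Fin n) : Module.Dual R (H R n) := LinearMap.proj i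

/-- The free Lie algebra `𝓛_n` over `R` on `x_1, …, x_n`. -/
abbrev FreeLie (R : Type) [CommRing R] (n : ℕ) : Type := FreeLieAlgebra R (Fin n)

/-- The left-normed commutator `[x_{j_1}, x_{j_2}, …, x_{j_{k+1}}]` of weight `k + 1`, that is,
`[[⋯[[x_{j_1}, x_{j_2}], x_{j_3}], ⋯], x_{j_{k+1}}]`. -/
def leftNormed (R : Type) [CommRing R] {n : ℕ} : (k : ℕ) → (Fin (k + 1) → Fin n) → FreeLie R n
  | 0, j => FreeLieAlgebra.of R (j 0)
  | k + 1, j => ⁅leftNormed R k (Fin.init j), FreeLieAlgebra.of R (j (Fin.last (k + 1)))⁆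

/-- The homogeneous part `𝓛_n(k)` of weight `k ≥ 1` of the free Lie algebra: the submodule spanned
by the left-normed commutators of weight `k` in the generators (and `𝓛_n(0) = 0`). -/
def lieDeg (R : Type) [CommRing R] (n : ℕ) : ℕ → Submodule R (FreeLie R n)
  | 0 => ⊥
  | k + 1 => Submodule.span R (Set.range (leftNormed R (n := n) k))

lemma leftNormed_mem (R : Type) [CommRing R] {n k : ℕ} (j : Fin (k + 1) → Fin n) :
    leftNormed R k j ∈ lieDeg R n (k + 1) :=
  Submodule.subset_span ⟨j, rfl⟩

/-- The degree `k` part of the derivation algebra of `𝓛_n` (for `k ≥ 1`), in the standard form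
`Hom(H, 𝓛_n(k+1)) = H^* ⊗ 𝓛_n(k+1)`: a derivation of a free Lie algebra is determined by its
values on the generators, which are arbitrary. -/
abbrev Der (R : Type) [CommRing R] (n k : ℕ) : Type :=
  Module.Dual R (H R n) ⊗[R] lieDeg R n (k + 1)

/-- The tangential derivations `𝔭_n(k)` of degree `k`: the submodule generated by the elements
`x_i^* ⊗ [x_{j_1}, …, x_{j_k}, x_i]`. -/
def tangential (R : Type) [CommRing R] (n k : ℕ) : Submodule R (Der R n k) :=
  Submodule.span R {t | ∃ (i : Fin n) (j : Fin k → Fin n),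
    t = xDual R i ⊗ₜ[R] (⟨leftNormed R k (Fin.snoc (α := fun _ => Fin n) j i),
      leftNormed_mem R _⟩ : lieDeg R n (k + 1))}

/-- The submodule of all `∑ i, x_i^* ⊗ C_i` with `∑ i, C_i = 0`, i.e. of the derivations that
kill `x_1 + ⋯ + x_n`. -/
def killsSum (R : Type) [CommRing R] (n k : ℕ) : Submodule R (Der R n k) where
  carrier := {t | ∃ C : Fin n → lieDeg R n (k + 1),
    t = ∑ i, xDual R i ⊗ₜ[R] C i ∧ ∑ i, C i = 0}
  zero_mem' := ⟨0, by simp, by simp⟩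
  add_mem' := by
    rintro _ _ ⟨C, rfl, hC⟩ ⟨D, rfl, hD⟩
    exact ⟨C + D, by simp [TensorProduct.tmul_add, Finset.sum_add_distrib],
      by simp [Finset.sum_add_distrib, hC, hD]⟩
  smul_mem' := by
    rintro c _ ⟨C, rfl, hC⟩
    exact ⟨c • C, by simp only [Pi.smul_apply, TensorProduct.tmul_smul, Finset.smul_sum],
      by simp only [Pi.smul_apply, ← Finset.smul_sum, hC, smul_zero]⟩

/-- The special derivations `𝔟_n(k)` of degree `k`. -/
def special (R : Type) [CommRing R] (n k : ℕ) : Submodule R (Der R n k) :=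
  tangential R n k ⊓ killsSum R n k

section
attribute [local instance] LieRing.ofAssociativeRing LieAlgebra.ofAssociativeAlgebra

/-- The natural map from the free Lie algebra to its enveloping algebra, the tensor algebra
`T(H)` (with the commutator bracket). -/
def toTensor (R : Type) [CommRing R] (n : ℕ) : FreeLie R n →ₗ[R] TensorAlgebra R (H R n) :=
  (FreeLieAlgebra.lift R (fun i : Fin n => TensorAlgebra.ι R (x R i))).toLinearMap

end

/-- The degree `k` part `ι_k : 𝓛_n(k) → H^{⊗k}` of the natural map `𝓛_n → T(H)`. -/
def iota (R : Type) [CommRing R] (n k : ℕ) : lieDeg R n k →ₗ[R] ⨂[R]^k (H R n) :=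
  DirectSum.component R ℕ (fun m => ⨂[R]^m (H R n)) k ∘ₗ
    (TensorAlgebra.equivDirectSum (R := R) (M := H R n)).toLinearMap ∘ₗ
    toTensor R n ∘ₗ (lieDeg R n k).subtype

/-- The contraction `H^* → Hom(H^{⊗(k+1)}, H^{⊗k})`,
`f ↦ (a_1 ⊗ ⋯ ⊗ a_{k+1} ↦ f(a_1) a_2 ⊗ ⋯ ⊗ a_{k+1})`. -/
def contractHom (R : Type) [CommRing R] (n k : ℕ) :
    Module.Dual R (H R n) →ₗ[R] (⨂[R]^(k + 1) (H R n)) →ₗ[R] ⨂[R]^k (H R n) where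
  toFun f := PiTensorProduct.lift (LinearMap.uncurryLeft (M := fun _ : Fin (k + 1) => H R n)
    (f.smulRight (PiTensorProduct.tprod R : MultilinearMap R (fun _ : Fin k => H R n) _)))
  map_add' f g := by
    refine PiTensorProduct.ext (MultilinearMap.ext fun a => ?_)
    simp [add_smul]
  map_smul' c f := by
    refine PiTensorProduct.ext (MultilinearMap.ext fun a => ?_)
    simp [mul_smul]

/-- The contraction `φ^k : H^* ⊗ H^{⊗(k+1)} → H^{⊗k}`. -/
def contract (R : Type) [CommRing R] (n k : ℕ) :
    Module.Dual R (H R n) ⊗[R] (⨂[R]^(k + 1) (H R n)) →ₗ[R] ⨂[R]^k (H R n) :=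
  TensorProduct.lift (contractHom R n k)

/-- `Φ^k = φ^k ∘ (id ⊗ ι_{k+1}) : H^* ⊗ 𝓛_n(k+1) → H^{⊗k}`. -/
def Phi (R : Type) [CommRing R] (n k : ℕ) : Der R n k →ₗ[R] ⨂[R]^k (H R n) :=
  contract R n k ∘ₗ LinearMap.lTensor (Module.Dual R (H R n)) (iota R n (k + 1))

/-- The submodule of `H^{⊗k}` generated by all
`a_1 ⊗ a_2 ⊗ ⋯ ⊗ a_k - a_2 ⊗ ⋯ ⊗ a_k ⊗ a_1`. -/
def cyclicRel (R : Type) [CommRing R] (n k : ℕ) : Submodule R (⨂[R]^k (H R n)) :=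
  Submodule.span R (Set.range fun a : Fin k → H R n =>
    PiTensorProduct.tprod R a - PiTensorProduct.tprod R (fun i => a (finRotate k i)))

/-- `𝓒_n(k)`, the coinvariants of `H^{⊗k}` under cyclic permutation of the factors. -/
abbrev Cyc (R : Type) [CommRing R] (n k : ℕ) : Type := (⨂[R]^k (H R n)) ⧸ cyclicRel R n k

/-- The trace map `Tr_k : H^* ⊗ 𝓛_n(k+1) → 𝓒_n(k)`. -/
def Tr (R : Type) [CommRing R] (n k : ℕ) : Der R n k →ₗ[R] Cyc R n k :=
  (cyclicRel R n k).mkQ ∘ₗ Phi R n k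

/-- The natural projection `𝓒_n(k) → S^k H` onto the symmetric power. -/
def cycToSym (R : Type) [CommRing R] (n k : ℕ) : Cyc R n k →ₗ[R] Sym[R]^k (H R n) :=
  (cyclicRel R n k).liftQ (SymmetricPower.mk R (Fin k) (H R n)) (by
    rw [cyclicRel, Submodule.span_le]
    rintro _ ⟨a, rfl⟩
    have h := SymmetricPower.tprod_equiv (R := R) (finRotate k) a
    change SymmetricPower.mk R (Fin k) (H R n) _ = 0
    rw [map_sub, sub_eq_zero]
    exact h.symm)

/-- The Morita trace `MT_k : H^* ⊗ 𝓛_n(k+1) → S^k H`. -/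
def moritaTrace (R : Type) [CommRing R] (n k : ℕ) : Der R n k →ₗ[R] Sym[R]^k (H R n) :=
  cycToSym R n k ∘ₗ Tr R n k

/-- The restriction `MT_k^B : 𝔟_n(k) → S^k H` of the Morita trace to the special derivations. -/
def moritaTraceSpecial (R : Type) [CommRing R] (n k : ℕ) : special R n k →ₗ[R] Sym[R]^k (H R n) :=
  moritaTrace R n k ∘ₗ (special R n k).subtype

end SpecialDer

end

/-! Embed `S^k H` in `ℤ[X_1, …, X_n]` as the forms of degree `k`. Write `∂_i w` for the contraction
of a Lie polynomial `w` by `x_i^*` in the first factor, made commutative. A tangential derivation `∑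
x_i^* ⊗ [w_i, x_i]` then has trace `∑ X_i ∂_i w_i`, and it is special exactly when `∑ [w_i, x_i] =
0`.

Upper bound: Euler's relation `∑ X_i ∂_i w = 0` in weight at least 2, together with `∂_i` of the
special condition, forces every trace to vanish at the points `e_i` and `e_i - e_j`. These `n +
n(n-1)/2` conditions are independent: they separate the corner monomials `X_i X_j^(k-1)`, `i ≤ j`,
so the corner span meets the image only in 0 (`sum_cornerMonomial_eq_zero`).

Lower bound: a caterpillar tree with a fork at each end gives a special derivation in whose trace
only the four fork leaves count (`caterpillar_mem_traceImage`). For odd `k` suitable forks give `2 m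
X_p X_q X_s` and `2 m X_p X_q (X_p + X_q)` for any monomial `m` of degree `k - 3` and distinct
indices. Modulo these, twice any monomial of degree `k` reduces to corner monomials
(`two_mul_monomial_mem`).

Hence image ⊕ corner span lies between `2V` and `V`, where `V` is the space of forms of degree `k`,
and the ranks add up. -/

noncomputable section

namespace SpecialDer

/-! ### Commutative Fox calculus on the free Lie algebra -/

section Representation

variable {R : Type} [CommRing R] {n : ℕ}

/-- The linear form `∑ j, a_j X_j` attached to a vector `a`. -/
def linForm (R : Type) [CommRing R] (n : ℕ) : H R n →ₗ[R] MvPolynomial (Fin n) R :=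
  Fintype.linearCombination R (fun j => (MvPolynomial.X j : MvPolynomial (Fin n) R))

@[simp] lemma linForm_x (j : Fin n) : linForm R n (x R j) = MvPolynomial.X j := by
  simp [linForm, x, Fintype.linearCombination_apply_single]

/-- The representation of the tensor algebra by upper triangular matrices whose upper right entry
on `a_1 ⊗ ⋯ ⊗ a_m` is `f(a_1) a_2 ⋯ a_m`. -/
def foxRep (f : Module.Dual R (H R n)) :
    TensorAlgebra R (H R n) →ₐ[R] Matrix (Fin 2) (Fin 2) (MvPolynomial (Fin n) R) :=
  TensorAlgebra.lift R
    { toFun := fun a => !![0, MvPolynomial.C (f a); 0, linForm R n a]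
      map_add' := fun a b => by
        ext i j : 2
        fin_cases i <;> fin_cases j <;> simp
      map_smul' := fun c a => by
        ext i j : 2
        fin_cases i <;> fin_cases j <;> simp [MvPolynomial.smul_eq_C_mul] }

@[simp] lemma foxRep_ι (f : Module.Dual R (H R n)) (a : H R n) :
    foxRep f (TensorAlgebra.ι R a) = !![0, MvPolynomial.C (f a); 0, linForm R n a] := by
  simp [foxRep]

/-- The contraction of a Lie polynomial by `f` in the first factor, with values in the symmetric
algebra. -/
def foxDeriv (f : Module.Dual R (H R n)) : FreeLie R n →ₗ[R] MvPolynomial (Fin n) R :=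
  Matrix.entryLinearMap R _ 0 1 ∘ₗ (foxRep f).toLinearMap ∘ₗ toTensor R n

/-- The abelianization of a Lie polynomial, as an entry of `foxRep f`. -/
def abel (f : Module.Dual R (H R n)) : FreeLie R n →ₗ[R] MvPolynomial (Fin n) R :=
  Matrix.entryLinearMap R _ 1 1 ∘ₗ (foxRep f).toLinearMap ∘ₗ toTensor R n

lemma foxDeriv_apply (f : Module.Dual R (H R n)) (w : FreeLie R n) :
    foxDeriv f w = foxRep f (toTensor R n w) 0 1 := rfl

lemma abel_apply (f : Module.Dual R (H R n)) (w : FreeLie R n) :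
    abel f w = foxRep f (toTensor R n w) 1 1 := rfl

@[simp] lemma toTensor_of (j : Fin n) :
    toTensor R n (FreeLieAlgebra.of R j) = TensorAlgebra.ι R (x R j) := by
  simp [toTensor]

lemma toTensor_lie (u v : FreeLie R n) :
    toTensor R n ⁅u, v⁆ = toTensor R n u * toTensor R n v - toTensor R n v * toTensor R n u := by
  let _ : LieRing (TensorAlgebra R (H R n)) := LieRing.ofAssociativeRing
  let _ : LieAlgebra R (TensorAlgebra R (H R n)) := LieAlgebra.ofAssociativeAlgebra
  exact LieHom.map_lie (FreeLieAlgebra.lift R (fun i : Fin n => TensorAlgebra.ι R (x R i))) u v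

/-- The elements satisfying `p` form a Lie subalgebra containing the generators; lifting the
generators into it and including back is the identity by freeness. -/
lemma freeLie_induction {p : FreeLie R n → Prop} (hof : ∀ j, p (FreeLieAlgebra.of R j))
    (hadd : ∀ u v, p u → p v → p (u + v)) (hsmul : ∀ (c : R) u, p u → p (c • u))
    (hlie : ∀ u v, p u → p v → p ⁅u, v⁆) (hzero : p 0) (w : FreeLie R n) : p w := by
  let S : LieSubalgebra R (FreeLie R n) :=
    { carrier := {w | p w}
      add_mem' := fun {u v} => hadd u v
      zero_mem' := hzero
      smul_mem' := fun c u => hsmul c u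
      lie_mem' := fun {u v} => hlie u v }
  have h : S.incl.comp (FreeLieAlgebra.lift R fun j => (⟨FreeLieAlgebra.of R j, hof j⟩ : S)) =
      LieHom.id := FreeLieAlgebra.hom_ext (by intro j; simp)
  have h2 := LieHom.congr_fun h w
  simp only [LieHom.comp_apply, LieHom.id_apply] at h2
  rw [← h2]
  exact (FreeLieAlgebra.lift R (fun j => (⟨FreeLieAlgebra.of R j, hof j⟩ : S)) w).2

/-- Generators have zero first column and brackets preserve this. It fails for the unit of the
tensor algebra, and it is what leaves only one term in each matrix product in `foxDeriv_lie`. -/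
lemma foxRep_toTensor_col_zero (f : Module.Dual R (H R n)) (w : FreeLie R n) :
    foxRep f (toTensor R n w) 0 0 = 0 ∧ foxRep f (toTensor R n w) 1 0 = 0 := by
  refine freeLie_induction (p := fun w => foxRep f (toTensor R n w) 0 0 = 0 ∧
    foxRep f (toTensor R n w) 1 0 = 0) ?_ ?_ ?_ ?_ ?_ w
  · intro j; simp
  · rintro u v ⟨h1, h2⟩ ⟨h3, h4⟩; simp [h1, h2, h3, h4]
  · rintro c u ⟨h1, h2⟩; simp [h1, h2]
  · rintro u v ⟨h1, h2⟩ ⟨h3, h4⟩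
    simp [toTensor_lie, Matrix.mul_apply, Fin.sum_univ_two, h1, h2, h3, h4]
  · simp

@[simp] lemma foxDeriv_of (f : Module.Dual R (H R n)) (j : Fin n) :
    foxDeriv f (FreeLieAlgebra.of R j) = MvPolynomial.C (f (x R j)) := by
  simp [foxDeriv_apply]

@[simp] lemma abel_of (f : Module.Dual R (H R n)) (j : Fin n) :
    abel f (FreeLieAlgebra.of R j) = MvPolynomial.X j := by
  simp [abel_apply]

lemma foxDeriv_lie (f : Module.Dual R (H R n)) (u v : FreeLie R n) :
    foxDeriv f ⁅u, v⁆ = foxDeriv f u * abel f v - foxDeriv f v * abel f u := by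
  have h1 := foxRep_toTensor_col_zero f u
  have h2 := foxRep_toTensor_col_zero f v
  simp [foxDeriv_apply, abel_apply, toTensor_lie, Matrix.mul_apply, Fin.sum_univ_two, h1, h2]

@[simp] lemma abel_lie (f : Module.Dual R (H R n)) (u v : FreeLie R n) : abel f ⁅u, v⁆ = 0 := by
  have h1 := foxRep_toTensor_col_zero f u
  have h2 := foxRep_toTensor_col_zero f v
  simp [abel_apply, toTensor_lie, Matrix.mul_apply, Fin.sum_univ_two, h1, h2, mul_comm]

lemma abel_eq_zero (f : Module.Dual R (H R n)) {m : ℕ} {w : FreeLie R n}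
    (hw : w ∈ lieDeg R n (m + 2)) : abel f w = 0 := by
  have : lieDeg R n (m + 2) ≤ LinearMap.ker (abel f) := by
    refine Submodule.span_le.2 ?_
    rintro _ ⟨j, rfl⟩
    simp [leftNormed]
  exact this hw

@[simp] lemma xDual_x (i j : Fin n) : xDual R i (x R j) = if i = j then 1 else 0 := by
  simp [xDual, x, Pi.single_apply]

/-- Euler's relation for the contractions of a Lie polynomial. -/
lemma sum_X_mul_foxDeriv {m : ℕ} {w : FreeLie R n} (hw : w ∈ lieDeg R n (m + 2)) :
    ∑ i, MvPolynomial.X i * foxDeriv (xDual R i) w = 0 := by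
  -- The induction must start in weight 2: for a generator `x_j` the sum is `X_j`. Beyond that,
  -- bracketing with a generator just multiplies each contraction by its variable.
  have key : ∀ (m : ℕ) (j : Fin (m + 2) → Fin n),
      ∑ i, MvPolynomial.X i * foxDeriv (xDual R i) (leftNormed R (m + 1) j) = 0 := by
    intro m
    induction m with
    | zero =>
      intro j
      have h : ∀ a b : Fin n, ∑ i, (MvPolynomial.X i : MvPolynomial (Fin n) R) *
          (MvPolynomial.C (if i = a then 1 else 0) * MvPolynomial.X b) =
            MvPolynomial.X a * MvPolynomial.X b := by
        intro a b
        rw [Finset.sum_eq_single a (by intro i _ hi; simp [hi]) (by simp)]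
        simp
      simp only [leftNormed, foxDeriv_lie, foxDeriv_of, abel_of, xDual_x, mul_sub,
        Finset.sum_sub_distrib, h]
      ring
    | succ m ih =>
      intro j
      have h : ∀ i, abel (xDual R i) (leftNormed R (m + 1) (Fin.init j)) = 0 := fun i =>
        abel_eq_zero _ (m := m) (leftNormed_mem R _)
      rw [leftNormed]
      simp only [foxDeriv_lie, h, mul_zero, sub_zero, abel_of, ← mul_assoc, ← Finset.sum_mul, ih,
        zero_mul]
  have : lieDeg R n (m + 2) ≤ LinearMap.ker
      (∑ i, LinearMap.mulLeft R (MvPolynomial.X i) ∘ₗ foxDeriv (xDual R i)) := by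
    refine Submodule.span_le.2 ?_
    rintro _ ⟨j, rfl⟩
    simpa using key m j
  simpa using this hw

end Representation

/-! ### The symmetric power as a space of polynomials -/

section SymmetricPower

variable {R : Type} [CommRing R] {n : ℕ}

/-- The multilinear product map on linear forms. -/
def prodForm (R : Type) [CommRing R] (n k : ℕ) :
    MultilinearMap R (fun _ : Fin k => H R n) (MvPolynomial (Fin n) R) :=
  (MultilinearMap.mkPiAlgebra R (Fin k) (MvPolynomial (Fin n) R)).compLinearMap
    (fun _ => linForm R n)

lemma prodForm_apply (k : ℕ) (a : Fin k → H R n) : prodForm R n k a = ∏ i, linForm R n (a i) := by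
  simp [prodForm]

/-- The additive map underlying `symToPoly`. -/
def symToPolyAddHom (R : Type) [CommRing R] (n k : ℕ) :
    Sym[R]^k (H R n) →+ MvPolynomial (Fin n) R :=
  AddCon.lift _ (PiTensorProduct.lift (prodForm R n k)).toAddMonoidHom
    (AddCon.addConGen_le.2 (by
      rintro _ _ ⟨e, a⟩
      rw [AddCon.ker_rel, LinearMap.toAddMonoidHom_coe, PiTensorProduct.lift.tprod, PiTensorProduct.lift.tprod, prodForm_apply, prodForm_apply]
      exact (Equiv.prod_comp e fun i => linForm R n (a i)).symm))

/-- The natural map from the symmetric power to polynomials. -/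
def symToPoly (R : Type) [CommRing R] (n k : ℕ) :
    Sym[R]^k (H R n) →ₗ[R] MvPolynomial (Fin n) R where
  __ := symToPolyAddHom R n k
  map_smul' c u := by
    induction u using AddCon.induction_on with
    | H u => exact map_smul (PiTensorProduct.lift (prodForm R n k)) c u

lemma symToPoly_mk (k : ℕ) (t : ⨂[R]^k (H R n)) :
    symToPoly R n k (SymmetricPower.mk R (Fin k) (H R n) t) =
      PiTensorProduct.lift (prodForm R n k) t := rfl

/-- The monomial of `Sym[R]^k H` with the given list of factors. -/
def symMonomial (R : Type) [CommRing R] {n k : ℕ} (j : Fin k → Fin n) : Sym[R]^k (H R n) :=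
  SymmetricPower.tprod R fun i => x R (j i)

lemma symToPoly_symMonomial {k : ℕ} (j : Fin k → Fin n) :
    symToPoly R n k (symMonomial R j) = MvPolynomial.monomial (∑ i, Finsupp.single (j i) 1) 1 := by
  change symToPoly R n k (SymmetricPower.mk R (Fin k) (H R n) _) = _
  rw [symToPoly_mk, PiTensorProduct.lift.tprod, prodForm_apply, MvPolynomial.monomial_sum_one]
  simp [MvPolynomial.X]

/-- Equal exponent vectors mean fibres of equal size, so `j` and `j'` differ by a permutation of the
positions. -/
lemma symMonomial_eq_of_sum_eq {k : ℕ} {j j' : Fin k → Fin n}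
    (h : (∑ i, Finsupp.single (j i) 1 : Fin n →₀ ℕ) = ∑ i, Finsupp.single (j' i) 1) :
    symMonomial R j = symMonomial R j' := by
  have hcard : ∀ c, Fintype.card {i // j i = c} = Fintype.card {i // j' i = c} := fun c => by
    have h2 := DFunLike.congr_fun h c
    simpa [Finsupp.single_apply, Fintype.card_subtype] using h2
  let σ : Equiv.Perm (Fin k) := Equiv.ofFiberEquiv fun c => Fintype.equivOfCardEq (hcard c)
  have hσ : j = j' ∘ σ := funext fun i => (Equiv.ofFiberEquiv_map _ i).symm
  calc symMonomial R j = symMonomial R (j' ∘ σ) := congrArg _ hσ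
    _ = symMonomial R j' := SymmetricPower.tprod_equiv σ (fun i => x R (j' i))

lemma span_symMonomial (k : ℕ) :
    Submodule.span R (Set.range (symMonomial R (n := n) (k := k))) = ⊤ := by
  have h := (Basis.piTensorProduct fun _ : Fin k => Pi.basisFun R (Fin n)).span_eq
  have h2 := congrArg (Submodule.map (SymmetricPower.mk R (Fin k) (H R n))) h
  rw [Submodule.map_top, SymmetricPower.range_mk, Submodule.map_span, ← Set.range_comp] at h2
  rw [← h2]
  congr 2
  funext j
  simp only [Function.comp_apply, Basis.piTensorProduct_apply, Pi.basisFun_apply]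
  rfl

lemma symToPoly_injective (k : ℕ) : Function.Injective (symToPoly R n k) := by
  classical
  -- A left inverse: each monomial of degree `k` goes to the symmetric monomial of any chosen word
  -- with that exponent vector.
  let ψ : MvPolynomial (Fin n) R →ₗ[R] Sym[R]^k (H R n) :=
    (MvPolynomial.basisMonomials (Fin n) R).constr R fun s =>
      if h : ∃ j : Fin k → Fin n, ∑ i, Finsupp.single (j i) 1 = s then symMonomial R h.choose else 0
  have hψ : ψ ∘ₗ symToPoly R n k = LinearMap.id := by
    refine LinearMap.ext_on_range (span_symMonomial k) fun j => ?_
    have hb := (MvPolynomial.basisMonomials (Fin n) R).constr_basis R (fun s =>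
      if h : ∃ j : Fin k → Fin n, ∑ i, Finsupp.single (j i) 1 = s then symMonomial R h.choose
      else 0) (∑ i, Finsupp.single (j i) 1)
    rw [MvPolynomial.coe_basisMonomials] at hb
    have he : ∃ j' : Fin k → Fin n, ∑ i, Finsupp.single (j' i) 1 =
      ∑ i, (Finsupp.single (j i) 1 : Fin n →₀ ℕ) := ⟨j, rfl⟩
    rw [LinearMap.comp_apply, symToPoly_symMonomial, hb, dif_pos he]
    exact symMonomial_eq_of_sum_eq he.choose_spec
  exact Function.LeftInverse.injective (g := ψ) fun u => LinearMap.congr_fun hψ u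

end SymmetricPower

/-! ### The Morita trace as a Fox derivative -/

section Trace

variable {R : Type} [CommRing R] {n : ℕ}

lemma toTensor_mem_range_pow {m : ℕ} {w : FreeLie R n} (hw : w ∈ lieDeg R n (m + 1)) :
    toTensor R n w ∈ LinearMap.range (TensorAlgebra.ι R (M := H R n)) ^ (m + 1) := by
  have key : ∀ (m : ℕ) (j : Fin (m + 1) → Fin n), toTensor R n (leftNormed R m j) ∈
      LinearMap.range (TensorAlgebra.ι R (M := H R n)) ^ (m + 1) := by
    intro m
    induction m with
    | zero => intro j; simp [leftNormed]
    | succ m ih =>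
      intro j
      rw [leftNormed, toTensor_lie, toTensor_of]
      refine Submodule.sub_mem _ ?_ ?_
      · rw [pow_succ]
        exact Submodule.mul_mem_mul (ih _) ⟨_, rfl⟩
      · rw [pow_succ']
        exact Submodule.mul_mem_mul ⟨_, rfl⟩ (ih _)
  have : lieDeg R n (m + 1) ≤
      (LinearMap.range (TensorAlgebra.ι R (M := H R n)) ^ (m + 1)).comap (toTensor R n) := by
    refine Submodule.span_le.2 ?_
    rintro _ ⟨j, rfl⟩
    exact key m j
  exact this hw

lemma range_pow_le_range_toTensorAlgebra (M : Type) [AddCommGroup M] [Module R M] (m : ℕ) :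
    LinearMap.range (TensorAlgebra.ι R (M := M)) ^ m ≤
      LinearMap.range (TensorPower.toTensorAlgebra (R := R) (M := M) (n := m)) := by
  induction m with
  | zero =>
    rw [pow_zero, Submodule.one_le]
    exact ⟨_, TensorPower.toTensorAlgebra_gOne⟩
  | succ m ih =>
    rw [pow_succ, Submodule.mul_le]
    rintro u hu _ ⟨a, rfl⟩
    obtain ⟨t, rfl⟩ := ih hu
    refine ⟨GradedMonoid.GMul.mul (A := fun n => ⨂[R]^n M) t
      (PiTensorProduct.tprod R fun _ : Fin 1 => a), ?_⟩
    rw [TensorPower.toTensorAlgebra_gMul]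
    simp

lemma equivDirectSum_toTensorAlgebra {M : Type} [AddCommGroup M] [Module R M] {m : ℕ}
    (t : ⨂[R]^m M) : TensorAlgebra.equivDirectSum (TensorPower.toTensorAlgebra t) =
      DirectSum.lof R ℕ (fun m => ⨂[R]^m M) m t := by
  have : (TensorAlgebra.equivDirectSum (R := R) (M := M)).toLinearMap ∘ₗ
      TensorPower.toTensorAlgebra = DirectSum.lof R ℕ (fun m => ⨂[R]^m M) m := by
    refine PiTensorProduct.ext (MultilinearMap.ext fun a => ?_)
    have := TensorAlgebra.toDirectSum_tensorPower_tprod (R := R) a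
    simp only [LinearMap.compMultilinearMap_apply, LinearMap.comp_apply,
      TensorPower.toTensorAlgebra_tprod]
    exact this
  exact LinearMap.congr_fun this t

/-- The tensor image of a weight `m + 1` element is already homogeneous, so projecting to that
degree loses nothing. -/
lemma toTensorAlgebra_iota {m : ℕ} (w : lieDeg R n (m + 1)) :
    TensorPower.toTensorAlgebra (iota R n (m + 1) w) = toTensor R n w := by
  obtain ⟨t, ht⟩ := range_pow_le_range_toTensorAlgebra (H R n) (m + 1)
    (toTensor_mem_range_pow w.2)
  have : iota R n (m + 1) w = t := by
    change DirectSum.component R ℕ (fun m => ⨂[R]^m (H R n)) (m + 1)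
      (TensorAlgebra.equivDirectSum (toTensor R n w)) = t
    rw [← ht, equivDirectSum_toTensorAlgebra, DirectSum.component.lof_self]
  rw [this, ht]

lemma foxRep_tprod (f : Module.Dual R (H R n)) {m : ℕ} (a : Fin m → H R n) :
    foxRep f (TensorAlgebra.tprod R _ m a) 1 1 = ∏ i, linForm R n (a i) ∧
      foxRep f (TensorAlgebra.tprod R _ m a) 1 0 = 0 := by
  induction m with
  | zero => simp [TensorAlgebra.tprod_apply]
  | succ m ih =>
    have h : TensorAlgebra.tprod R (H R n) (m + 1) a =
        TensorAlgebra.ι R (a 0) * TensorAlgebra.tprod R (H R n) m (fun i => a i.succ) := by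
      simp [TensorAlgebra.tprod_apply, List.ofFn_succ]
    obtain ⟨h1, h2⟩ := ih fun i => a i.succ
    rw [h, map_mul]
    simp [-TensorAlgebra.tprod_apply, Matrix.mul_apply, Fin.sum_univ_two, h1, h2,
      Fin.prod_univ_succ]

lemma foxRep_toTensorAlgebra (f : Module.Dual R (H R n)) {k : ℕ} (t : ⨂[R]^(k + 1) (H R n)) :
    foxRep f (TensorPower.toTensorAlgebra t) 0 1 =
      PiTensorProduct.lift (prodForm R n k) (contractHom R n k f t) := by
  have : Matrix.entryLinearMap R _ 0 1 ∘ₗ (foxRep f).toLinearMap ∘ₗ TensorPower.toTensorAlgebra =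
      PiTensorProduct.lift (prodForm R n k) ∘ₗ contractHom R n k f := by
    refine PiTensorProduct.ext (MultilinearMap.ext fun a => ?_)
    have h : TensorAlgebra.tprod R (H R n) (k + 1) a =
        TensorAlgebra.ι R (a 0) * TensorAlgebra.tprod R (H R n) k (fun i => a i.succ) := by
      simp [TensorAlgebra.tprod_apply, List.ofFn_succ]
    have h1 := (foxRep_tprod f fun i => a i.succ).1
    simp only [LinearMap.compMultilinearMap_apply, LinearMap.comp_apply,
      TensorPower.toTensorAlgebra_tprod, h, AlgHom.toLinearMap_apply, map_mul,
      Matrix.entryLinearMap_apply]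
    rw [Matrix.mul_apply, Fin.sum_univ_two, h1]
    simp [contractHom, prodForm_apply, MvPolynomial.smul_eq_C_mul, Fin.tail]
  exact LinearMap.congr_fun this t

lemma symToPoly_moritaTrace_tmul {k : ℕ} (f : Module.Dual R (H R n)) (c : lieDeg R n (k + 1)) :
    symToPoly R n k (moritaTrace R n k (f ⊗ₜ c)) = foxDeriv f c := by
  have h : moritaTrace R n k (f ⊗ₜ c) =
      SymmetricPower.mk R (Fin k) (H R n) (contractHom R n k f (iota R n (k + 1) c)) := rfl
  rw [h, symToPoly_mk, ← foxRep_toTensorAlgebra, toTensorAlgebra_iota, foxDeriv_apply]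

end Trace

/-! ### The grading of the free Lie algebra -/

section Lie

variable {R : Type} [CommRing R] {n : ℕ}

lemma lie_of_mem {m : ℕ} {w : FreeLie R n} (hw : w ∈ lieDeg R n (m + 1)) (i : Fin n) :
    ⁅w, FreeLieAlgebra.of R i⁆ ∈ lieDeg R n (m + 2) := by
  have : lieDeg R n (m + 1) ≤ (lieDeg R n (m + 2)).comap
      ((LieModule.toEnd R (FreeLie R n) (FreeLie R n) (FreeLieAlgebra.of R i))) := by
    refine Submodule.span_le.2 ?_
    rintro _ ⟨j, rfl⟩
    have h := Submodule.neg_mem _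
      (leftNormed_mem R (Fin.snoc (α := fun _ => Fin n) j i))
    rw [leftNormed, Fin.init_snoc, Fin.snoc_last, lie_skew] at h
    exact h
  have h := Submodule.neg_mem _ (Submodule.mem_comap.1 (this hw))
  rw [LieModule.toEnd_apply_apply, lie_skew] at h
  exact h

lemma of_mem (i : Fin n) : FreeLieAlgebra.of R i ∈ lieDeg R n 1 :=
  leftNormed_mem R (k := 0) fun _ => i

/-- The Jacobi identity `[u, [v, x]] = [[u, v], x] + [v, [u, x]]` lowers the weight of the second
factor. -/
lemma lie_mem {a b : ℕ} {u v : FreeLie R n} (hu : u ∈ lieDeg R n (a + 1))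
    (hv : v ∈ lieDeg R n (b + 1)) : ⁅u, v⁆ ∈ lieDeg R n (a + b + 2) := by
  induction b generalizing a u v with
  | zero =>
    have : lieDeg R n (0 + 1) ≤ (lieDeg R n (a + 2)).comap
        (LieModule.toEnd R (FreeLie R n) (FreeLie R n) u) := by
      refine Submodule.span_le.2 ?_
      rintro _ ⟨j, rfl⟩
      exact lie_of_mem hu _
    exact this hv
  | succ b ih =>
    have : lieDeg R n (b + 1 + 1) ≤ (lieDeg R n (a + (b + 1) + 2)).comap
        (LieModule.toEnd R (FreeLie R n) (FreeLie R n) u) := by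
      refine Submodule.span_le.2 ?_
      rintro _ ⟨j, rfl⟩
      have hj := leftNormed_mem R (Fin.init j)
      have h1 := lie_of_mem (ih hu hj) (j (Fin.last (b + 1)))
      have h2 := ih (lie_of_mem hu (j (Fin.last (b + 1)))) hj
      have e : a + 1 + b + 2 = a + (b + 1) + 2 := by omega
      rw [e] at h2
      change ⁅u, ⁅_, _⁆⁆ ∈ lieDeg R n (a + (b + 1) + 2)
      rw [leibniz_lie]
      refine Submodule.add_mem _ h1 ?_
      rw [← lie_skew]
      exact Submodule.neg_mem _ h2
    exact this hv

end Lie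

/-! ### Special derivations and the vanishing conditions on their traces -/

section Image

variable {R : Type} [CommRing R] {n : ℕ}

/-- The map `w ↦ [w, x_i]` on the weight `m + 1` part. -/
def bracketOf (R : Type) [CommRing R] {n : ℕ} (m : ℕ) (i : Fin n) :
    lieDeg R n (m + 1) →ₗ[R] lieDeg R n (m + 2) where
  toFun w := ⟨⁅(w : FreeLie R n), FreeLieAlgebra.of R i⁆, lie_of_mem w.2 i⟩
  map_add' u v := by ext; simp
  map_smul' c u := by ext; simp

@[simp] lemma coe_bracketOf {m : ℕ} (i : Fin n) (w : lieDeg R n (m + 1)) :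
    (bracketOf R m i w : FreeLie R n) = ⁅(w : FreeLie R n), FreeLieAlgebra.of R i⁆ := rfl

lemma mem_tangential_iff {m : ℕ} {t : Der R n (m + 1)} : t ∈ tangential R n (m + 1) ↔
    ∃ w : Fin n → lieDeg R n (m + 1), t = ∑ i, xDual R i ⊗ₜ bracketOf R m i (w i) := by
  constructor
  · intro ht
    let T : (Fin n → lieDeg R n (m + 1)) →ₗ[R] Der R n (m + 1) :=
      ∑ i, TensorProduct.mk R _ _ (xDual R i) ∘ₗ bracketOf R m i ∘ₗ LinearMap.proj i
    have hT : ∀ w, T w = ∑ i, xDual R i ⊗ₜ bracketOf R m i (w i) := fun w => by simp [T]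
    have : tangential R n (m + 1) ≤ LinearMap.range T := by
      refine Submodule.span_le.2 ?_
      rintro _ ⟨i, j, rfl⟩
      refine ⟨Pi.single i ⟨leftNormed R m j, leftNormed_mem R j⟩, ?_⟩
      rw [hT, Finset.sum_eq_single i (by intro b _ hb; simp [hb]) (by simp)]
      congr 1
      ext
      simp [leftNormed]
    obtain ⟨w, rfl⟩ := this ht
    exact ⟨w, hT w⟩
  · rintro ⟨w, rfl⟩
    refine Submodule.sum_mem _ fun i _ => ?_
    obtain ⟨w, hw⟩ := w i
    refine Submodule.span_induction (p := fun w hw =>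
      xDual R i ⊗ₜ bracketOf R m i ⟨w, hw⟩ ∈ tangential R n (m + 1)) ?_ ?_ ?_ ?_ hw
    · rintro _ ⟨j, rfl⟩
      refine Submodule.subset_span ⟨i, j, ?_⟩
      congr 1
      ext
      simp [leftNormed]
    · change xDual R i ⊗ₜ bracketOf R m i 0 ∈ tangential R n (m + 1)
      rw [map_zero, TensorProduct.tmul_zero]
      exact Submodule.zero_mem _
    · intro u v hu hv h1 h2
      convert Submodule.add_mem _ h1 h2 using 1
      rw [← TensorProduct.tmul_add]
      congr 1
      ext; simp
    · intro c u hu h1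
      convert Submodule.smul_mem _ c h1 using 1
      rw [← TensorProduct.tmul_smul]
      congr 1
      ext; simp

/-- The coefficient of `x_i^*`, i.e. the value of a derivation at `x_i`. -/
def valueAt (R : Type) [CommRing R] {n k : ℕ} (i : Fin n) :
    Der R n k →ₗ[R] lieDeg R n (k + 1) :=
  TensorProduct.lift
    (LinearMap.lsmul R (lieDeg R n (k + 1)) ∘ₗ Module.Dual.eval R (H R n) (x R i))

lemma valueAt_sum {k : ℕ} (i : Fin n) (c : Fin n → lieDeg R n (k + 1)) :
    valueAt R i (∑ j, xDual R j ⊗ₜ[R] c j) = c i := by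
  simp [valueAt]

lemma mem_special_iff {m : ℕ} {t : Der R n (m + 1)} : t ∈ special R n (m + 1) ↔
    ∃ w : Fin n → lieDeg R n (m + 1), ∑ i, ⁅(w i : FreeLie R n), FreeLieAlgebra.of R i⁆ = 0 ∧
      t = ∑ i, xDual R i ⊗ₜ bracketOf R m i (w i) := by
  rw [special, Submodule.mem_inf, mem_tangential_iff]
  constructor
  · rintro ⟨⟨w, rfl⟩, c, hc, hc0⟩
    refine ⟨w, ?_, rfl⟩
    -- The tangential and sum-killing presentations agree because the coefficients of the `x_i^*`
    -- are unique.
    have h : ∀ i, bracketOf R m i (w i) = c i := fun i => by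
      rw [← valueAt_sum i c, ← hc, valueAt_sum i fun i => bracketOf R m i (w i)]
    have := congrArg (Subtype.val) hc0
    simpa [← h] using this
  · rintro ⟨w, hw, rfl⟩
    refine ⟨⟨w, rfl⟩, _, rfl, ?_⟩
    ext
    simpa using hw

/-- The Morita trace of the special derivations, in terms of polynomials. -/
def traceImage (R : Type) [CommRing R] (n k : ℕ) : Submodule R (MvPolynomial (Fin n) R) :=
  (LinearMap.range (moritaTraceSpecial R n k)).map (symToPoly R n k)

lemma mem_traceImage_iff {m : ℕ} {p : MvPolynomial (Fin n) R} : p ∈ traceImage R n (m + 2) ↔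
    ∃ w : Fin n → lieDeg R n (m + 2), ∑ i, ⁅(w i : FreeLie R n), FreeLieAlgebra.of R i⁆ = 0 ∧
      p = ∑ i, MvPolynomial.X i * foxDeriv (xDual R i) (w i) := by
  have key : ∀ w : Fin n → lieDeg R n (m + 2), symToPoly R n (m + 2) (moritaTrace R n (m + 2)
      (∑ i, xDual R i ⊗ₜ bracketOf R (m + 1) i (w i))) =
        ∑ i, MvPolynomial.X i * foxDeriv (xDual R i) (w i) := fun w => by
    rw [map_sum, map_sum]
    refine Finset.sum_congr rfl fun i _ => ?_
    rw [symToPoly_moritaTrace_tmul, coe_bracketOf, foxDeriv_lie, abel_of,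
      abel_eq_zero _ (w i).2, mul_zero, sub_zero, mul_comm]
  constructor
  · rintro ⟨_, ⟨⟨t, ht⟩, rfl⟩, rfl⟩
    obtain ⟨w, hw, rfl⟩ := mem_special_iff.1 ht
    exact ⟨w, hw, key w⟩
  · rintro ⟨w, hw, rfl⟩
    exact ⟨_, ⟨⟨_, mem_special_iff.2 ⟨w, hw, rfl⟩⟩, rfl⟩, key w⟩

-- At `e_i` only `∂_i w_i` survives in the trace, and Euler's relation for `w_i` at `e_i` says that
-- it vanishes.
open MvPolynomial in
lemma eval_single_eq_zero {m : ℕ} {p : MvPolynomial (Fin n) R}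
    (hp : p ∈ traceImage R n (m + 2)) (i : Fin n) : eval (Pi.single i 1) p = 0 := by
  obtain ⟨w, -, rfl⟩ := mem_traceImage_iff.1 hp
  have h := congrArg (eval (Pi.single i 1)) (sum_X_mul_foxDeriv (w i).2)
  simpa [Pi.single_apply] using h

open MvPolynomial in
lemma eval_single_sub_single_eq_zero {m : ℕ} {p : MvPolynomial (Fin n) R}
    (hp : p ∈ traceImage R n (m + 2)) {i j : Fin n} :
    eval (Pi.single i 1 - Pi.single j 1) p = 0 := by
  obtain ⟨w, hw, rfl⟩ := mem_traceImage_iff.1 hp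
  -- At `e_i - e_j`, Euler for `w_j` gives `∂_i w_j = ∂_j w_j`, and `∂_i` of the special condition
  -- gives `∂_i w_i = ∂_i w_j`. The trace there is `∂_i w_i - ∂_j w_j`.
  have h := congrArg (eval (Pi.single i 1 - Pi.single j 1)) (sum_X_mul_foxDeriv (w j).2)
  have h2 := congrArg (eval (Pi.single i 1 - Pi.single j 1))
    (congrArg (foxDeriv (xDual R i)) hw)
  have h3 : ∀ l, foxDeriv (xDual R i) ⁅(w l : FreeLie R n), FreeLieAlgebra.of R l⁆ =
      X l * foxDeriv (xDual R i) (w l) := fun l => by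
    rw [foxDeriv_lie, abel_of, abel_eq_zero _ (w l).2, mul_zero, sub_zero, mul_comm]
  simp only [map_sum, h3] at h2
  simp [Pi.single_apply, sub_mul, Finset.sum_sub_distrib] at h h2 ⊢
  linear_combination h + h2

end Image

/-! ### Special derivations from caterpillar trees -/

section Caterpillar

variable {R : Type} [CommRing R] {n : ℕ}

/-- The left-normed bracket `[u, x_{c_1}, …, x_{c_r}]`. -/
def bracketList (R : Type) [CommRing R] {n : ℕ} (u : FreeLie R n) (c : List (Fin n)) :
    FreeLie R n :=
  c.foldl (fun u i => ⁅u, FreeLieAlgebra.of R i⁆) u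

@[simp] lemma bracketList_nil (u : FreeLie R n) : bracketList R u [] = u := rfl

@[simp] lemma bracketList_cons (u : FreeLie R n) (i : Fin n) (c : List (Fin n)) :
    bracketList R u (i :: c) = bracketList R ⁅u, FreeLieAlgebra.of R i⁆ c := rfl

@[simp] lemma bracketList_concat (u : FreeLie R n) (i : Fin n) (c : List (Fin n)) :
    bracketList R u (c ++ [i]) = ⁅bracketList R u c, FreeLieAlgebra.of R i⁆ := by
  simp [bracketList]

lemma bracketList_mem {a : ℕ} {u : FreeLie R n} (hu : u ∈ lieDeg R n (a + 1))
    (c : List (Fin n)) : bracketList R u c ∈ lieDeg R n (a + c.length + 1) := by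
  induction c generalizing a u with
  | nil => exact hu
  | cons i c ih =>
    have h := ih (lie_of_mem hu i)
    rwa [show a + 1 + c.length + 1 = a + (i :: c).length + 1 by simp; omega] at h

lemma foxDeriv_bracketList (f : Module.Dual R (H R n)) {a : ℕ} {u : FreeLie R n}
    (hu : u ∈ lieDeg R n (a + 2)) (c : List (Fin n)) :
    foxDeriv f (bracketList R u c) = foxDeriv f u * (c.map MvPolynomial.X).prod := by
  induction c generalizing a u with
  | nil => simp
  | cons i c ih =>
    rw [bracketList_cons, ih (lie_of_mem hu i), foxDeriv_lie, abel_eq_zero f hu]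
    simp [mul_assoc]

/-- The sum `∑ [w_i, x_i]`. -/
def bracketSum (R : Type) [CommRing R] (n : ℕ) : (Fin n → FreeLie R n) →ₗ[R] FreeLie R n where
  toFun w := ∑ i, ⁅w i, FreeLieAlgebra.of R i⁆
  map_add' u v := by simp [Finset.sum_add_distrib]
  map_smul' c u := by simp [Finset.smul_sum]

/-- The Morita trace of `∑ x_i^* ⊗ [w_i, x_i]`. -/
def traceSum (R : Type) [CommRing R] (n : ℕ) :
    (Fin n → FreeLie R n) →ₗ[R] MvPolynomial (Fin n) R :=
  ∑ i, LinearMap.mulLeft R (MvPolynomial.X i) ∘ₗ foxDeriv (xDual R i) ∘ₗ LinearMap.proj i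

lemma bracketSum_single (i : Fin n) (u : FreeLie R n) :
    bracketSum R n (Pi.single i u) = ⁅u, FreeLieAlgebra.of R i⁆ := by
  change ∑ j, ⁅Pi.single (M := fun _ => FreeLie R n) i u j, FreeLieAlgebra.of R j⁆ = _
  rw [Finset.sum_eq_single i (by intro j _ hj; simp [hj]) (by simp)]
  simp

lemma traceSum_apply (w : Fin n → FreeLie R n) :
    traceSum R n w = ∑ i, MvPolynomial.X i * foxDeriv (xDual R i) (w i) := by
  simp [traceSum]

lemma traceSum_single (i : Fin n) (u : FreeLie R n) :
    traceSum R n (Pi.single i u) = MvPolynomial.X i * foxDeriv (xDual R i) u := by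
  rw [traceSum_apply, Finset.sum_eq_single i (by intro j _ hj; simp [hj]) (by simp)]
  simp

lemma mem_traceImage {m : ℕ} {w : Fin n → FreeLie R n} (hw : ∀ i, w i ∈ lieDeg R n (m + 2))
    (h : bracketSum R n w = 0) : traceSum R n w ∈ traceImage R n (m + 2) :=
  mem_traceImage_iff.2 ⟨fun i => ⟨w i, hw i⟩, h, traceSum_apply w⟩

lemma single_mem {N : ℕ} {u : FreeLie R n} (hu : u ∈ lieDeg R n N) (i j : Fin n) :
    Pi.single (M := fun _ => FreeLie R n) i u j ∈ lieDeg R n N := by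
  rcases eq_or_ne j i with rfl | h
  · simpa using hu
  · simp [h]

lemma lie_lie_right (u v w : FreeLie R n) : ⁅u, ⁅v, w⁆⁆ = ⁅⁅u, v⁆, w⁆ - ⁅⁅u, w⁆, v⁆ := by
  rw [leibniz_lie, ← lie_skew v, sub_eq_add_neg]

/-- Moving the letters of `c` from one factor of a bracket to the other one changes the bracket by
the bracket sum of a family with vanishing Morita trace, up to sign. -/
lemma exists_lie_bracketList_eq {b : ℕ} {v : FreeLie R n} (hv : v ∈ lieDeg R n (b + 2))
    (c : List (Fin n)) {a : ℕ} {u : FreeLie R n} (hu : u ∈ lieDeg R n (a + 2)) :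
    ∃ w : Fin n → FreeLie R n, (∀ i, w i ∈ lieDeg R n (a + b + c.length + 3)) ∧
      traceSum R n w = 0 ∧ ⁅bracketList R u c, v⁆ =
        (-1 : R) ^ c.length • ⁅u, bracketList R v c.reverse⁆ + bracketSum R n w := by
  induction c generalizing a u with
  | nil => exact ⟨0, fun i => Submodule.zero_mem _, map_zero _, by simp⟩
  | cons j c ih =>
    obtain ⟨w, hw, hw0, hs⟩ := ih (lie_of_mem hu j)
    set v' := bracketList R v c.reverse with hv'
    have hv'm : v' ∈ lieDeg R n (b + c.length + 1 + 1) := by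
      have := bracketList_mem hv c.reverse
      rwa [show b + 1 + c.reverse.length + 1 = b + c.length + 1 + 1 by simp; omega] at this
    have hmem : ⁅u, v'⁆ ∈ lieDeg R n (a + b + (j :: c).length + 3) := by
      have := lie_mem hu hv'm
      rwa [show a + 1 + (b + c.length + 1) + 2 = a + b + (j :: c).length + 3 by simp; omega]
        at this
    -- Jacobi reads `[[u, x_j], v'] = [[u, v'], x_j] - [u, [v', x_j]]`. The correction `[u, v']` has
    -- zero contraction since both factors have weight at least 2.
    refine ⟨w + (-1 : R) ^ c.length • Pi.single (M := fun _ => FreeLie R n) j ⁅u, v'⁆, fun i => ?_, ?_, ?_⟩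
    · have hi := hw i
      rw [show a + 1 + b + c.length + 3 = a + b + (j :: c).length + 3 by simp; omega] at hi
      exact Submodule.add_mem _ hi (Submodule.smul_mem _ _ (single_mem hmem j i))
    · rw [map_add, map_smul, traceSum_single, foxDeriv_lie, abel_eq_zero _ hu,
        abel_eq_zero _ hv'm, hw0]
      simp
    · rw [bracketList_cons, hs, map_add, map_smul, bracketSum_single, List.reverse_cons,
        bracketList_concat, ← hv', List.length_cons, pow_succ, lie_lie_right u]
      module

open MvPolynomial in
/-- The Morita trace of the special derivation attached to a caterpillar tree with forks
`(p, q)` and `(s, r)`. -/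
lemma caterpillar_mem_traceImage (p q r s : Fin n) (c : List (Fin n)) (hc : Even c.length) :
    (c.map X).prod * (
      X r * X s * (C (xDual R r (x R p)) * X q - C (xDual R r (x R q)) * X p)
      - X s * X r * (C (xDual R s (x R p)) * X q - C (xDual R s (x R q)) * X p)
      + X q * X p * (C (xDual R q (x R s)) * X r - C (xDual R q (x R r)) * X s)
      - X p * X q * (C (xDual R p (x R s)) * X r - C (xDual R p (x R r)) * X s)) ∈
        traceImage R n (c.length + 1 + 2) := by
  have hpq := lie_of_mem (of_mem (R := R) p) q
  have hsr := lie_of_mem (of_mem (R := R) s) r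
  obtain ⟨w, hw, hw0, hs⟩ := exists_lie_bracketList_eq hsr c hpq
  have hL := bracketList_mem hpq c
  have hM := bracketList_mem hsr c.reverse
  have hfL : ∀ f, _ := fun f => foxDeriv_bracketList f hpq c
  have hfM : ∀ f, _ := fun f => foxDeriv_bracketList f hsr c.reverse
  have haL : ∀ f, abel f (bracketList R ⁅FreeLieAlgebra.of R p, FreeLieAlgebra.of R q⁆ c) = 0 :=
    fun f => abel_eq_zero f (m := c.length) (by convert hL using 2; omega)
  have haM : ∀ f, abel f
      (bracketList R ⁅FreeLieAlgebra.of R s, FreeLieAlgebra.of R r⁆ c.reverse) = 0 :=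
    fun f => abel_eq_zero f (m := c.length) (by convert hM using 2; simp; omega)
  set L := bracketList R ⁅FreeLieAlgebra.of R p, FreeLieAlgebra.of R q⁆ c
  set M := bracketList R ⁅FreeLieAlgebra.of R s, FreeLieAlgebra.of R r⁆ c.reverse
  have e1 : 0 + 1 + c.length + 2 = c.length + 1 + 2 := by omega
  have e2 : 0 + 1 + c.reverse.length + 2 = c.length + 1 + 2 := by simp; omega
  have e3 : 0 + 0 + c.length + 3 = c.length + 1 + 2 := by omega
  have m1 : ∀ j i, Pi.single (M := fun _ => FreeLie R n) j ⁅L, FreeLieAlgebra.of R i⁆ ∈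
    Submodule.pi Set.univ (fun _ => lieDeg R n (c.length + 1 + 2)) := fun j i l _ =>
      single_mem (e1 ▸ lie_of_mem hL i) j l
  have m2 : ∀ j i, Pi.single (M := fun _ => FreeLie R n) j ⁅M, FreeLieAlgebra.of R i⁆ ∈
    Submodule.pi Set.univ (fun _ => lieDeg R n (c.length + 1 + 2)) := fun j i l _ =>
      single_mem (e2 ▸ lie_of_mem hM i) j l
  have m3 : w ∈ Submodule.pi Set.univ (fun _ => lieDeg R n (c.length + 1 + 2)) := fun j _ =>
    e3 ▸ hw j
  -- As `c` has even length, `[L, [x_s, x_r]] - [[x_p, x_q], M]` is the bracket sum of `w`. Jacobi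
  -- on the two forks splits the left side into four brackets ending in the fork leaves; subtracting
  -- `w` makes the total bracket sum zero.
  have m := Submodule.sub_mem _ (Submodule.sub_mem _ (Submodule.add_mem _ (Submodule.sub_mem _
    (m1 r s) (m1 s r)) (m2 q p)) (m2 p q)) m3
  have key := mem_traceImage (fun i => m i trivial) (by
    simp only [map_sub, map_add, bracketSum_single]
    rw [hc.neg_one_pow, one_smul] at hs
    rw [← sub_eq_iff_eq_add'.2 hs]
    rw [lie_lie_right L, ← lie_skew ⁅FreeLieAlgebra.of R p, FreeLieAlgebra.of R q⁆ M,
      lie_lie_right M]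
    abel)
  convert key using 1
  simp only [map_sub, map_add, traceSum_single, foxDeriv_lie, hw0, haL, haM, abel_of, hfL, hfM,
    foxDeriv_of, List.map_reverse, List.prod_reverse]
  ring

end Caterpillar

/-! ### Corner monomials and the rank count -/

section Count

open MvPolynomial

variable {n : ℕ}

lemma two_mul_distinct_mem (c : List (Fin n)) (hc : Even c.length) {p q s : Fin n}
    (hpq : p ≠ q) (hps : p ≠ s) (hqs : q ≠ s) :
    2 * ((c.map X).prod * (X p * X q * X s)) ∈ traceImage ℤ n (c.length + 1 + 2) := by
  -- Forks `(p, q)` and `(s, p)`: the two leaves labelled `p` each contribute `X_p X_q X_s`.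
  convert caterpillar_mem_traceImage (R := ℤ) p q p s c hc using 1
  simp [hpq, hpq.symm, hps.symm, hqs, hqs.symm, hps]
  ring

lemma two_mul_pair_mem (c : List (Fin n)) (hc : Even c.length) {p q : Fin n} (hpq : p ≠ q) :
    2 * ((c.map X).prod * (X p * X q * (X p + X q))) ∈ traceImage ℤ n (c.length + 1 + 2) := by
  convert caterpillar_mem_traceImage (R := ℤ) p q p q c hc using 1
  simp [hpq, hpq.symm]
  ring

/-- The monomials `X_i X_j^{k-1}` with `i ≤ j`. -/
def cornerMonomial (n k : ℕ) (ij : {p : Fin n × Fin n // p.1 ≤ p.2}) : MvPolynomial (Fin n) ℤ :=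
  X ij.1.1 * X ij.1.2 ^ (k - 1)

lemma two_mul_pow_mul_pow_mem {l : ℕ} (hl : Even l) {p q : Fin n} (hpq : p < q) (a b : ℕ)
    (hab : a + b = l + 1) : 2 * (X p ^ (a + 1) * X q ^ (b + 1)) ∈
      traceImage ℤ n (l + 1 + 2) ⊔ Submodule.span ℤ (Set.range (cornerMonomial n (l + 1 + 2))) := by
  induction a generalizing b with
  | zero =>
    refine Submodule.mem_sup_right ?_
    have h : cornerMonomial n (l + 1 + 2) ⟨(p, q), hpq.le⟩ ∈
        Submodule.span ℤ (Set.range (cornerMonomial n (l + 1 + 2))) :=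
      Submodule.subset_span ⟨_, rfl⟩
    convert Submodule.smul_mem _ (2 : ℤ) h using 1
    simp [cornerMonomial, show b = l + 1 by omega, two_mul, two_smul]
  | succ a ih =>
    have h1 := ih (b + 1) (by omega)
    -- Modulo the image, `X_p^(a+2) X_q^(b+1)` is the negative of `X_p^(a+1) X_q^(b+2)` after
    -- doubling, so powers of `X_p` can be traded down to the corner.
    have h2 := two_mul_pair_mem (List.replicate a p ++ List.replicate b q)
      (by simpa [show a + b = l by omega] using hl) hpq.ne
    have e : (List.replicate a p ++ List.replicate b q).length = l := by simp; omega
    rw [e] at h2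
    convert Submodule.sub_mem _ (Submodule.mem_sup_left h2) h1 using 1
    simp
    ring

lemma prod_map_X_toMultiset (d : Fin n →₀ ℕ) :
    (d.toMultiset.map X).prod = monomial d (1 : ℤ) := by
  rw [Finsupp.toMultiset_map, Finsupp.prod_toMultiset, monomial_eq, C_1, one_mul,
    Finsupp.prod_mapDomain_index (by simp) (by simp [pow_add])]

/-- The case depends on how many variables occur: with three or more, the doubled monomial is itself
a trace; a pure power is a corner monomial; two variables reduce to a corner by trading exponents.
-/
lemma two_mul_monomial_mem {l : ℕ} (hl : Even l) (d : Fin n →₀ ℕ) (hd : d.degree = l + 3) :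
    2 * monomial d (1 : ℤ) ∈
      traceImage ℤ n (l + 1 + 2) ⊔ Submodule.span ℤ (Set.range (cornerMonomial n (l + 1 + 2))) := by
  rcases lt_or_ge 2 d.support.card with h | h
  · refine Submodule.mem_sup_left ?_
    obtain ⟨p, hp, q, hq, s, hs, hpq, hps, hqs⟩ := Finset.two_lt_card.1 h
    rw [Finsupp.mem_support_iff] at hp hq hs
    have hle : Finsupp.single p 1 + Finsupp.single q 1 + Finsupp.single s 1 ≤ d := by
      intro i
      simp only [Finsupp.add_apply, Finsupp.single_apply]
      by_cases h1 : p = i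
      · subst h1; simp [hpq.symm, hps.symm]; omega
      by_cases h2 : q = i
      · subst h2; simp [hpq, hqs.symm]; omega
      by_cases h3 : s = i
      · subst h3; simp [hps, hqs]; omega
      simp [h1, h2, h3]
    obtain ⟨d', rfl⟩ := le_iff_exists_add.1 hle
    have hd' : d'.degree = l := by
      simp only [map_add, Finsupp.degree_single] at hd
      omega
    have hlen : d'.toMultiset.toList.length = l := by
      simp [Finsupp.card_toMultiset, ← hd', Finsupp.degree_apply, Finsupp.sum]
    have h2 := two_mul_distinct_mem d'.toMultiset.toList (hlen.symm ▸ hl) hpq hps hqs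
    rw [hlen] at h2
    convert h2 using 2
    rw [← Multiset.prod_coe, ← Multiset.map_coe, Multiset.coe_toList,
      prod_map_X_toMultiset, X, X, X, monomial_mul, monomial_mul, monomial_mul,
      add_comm d']
    simp
  · interval_cases hcard : d.support.card
    · rw [Finset.card_eq_zero, Finsupp.support_eq_empty] at hcard
      simp [hcard] at hd
    · obtain ⟨p, b, hb, rfl⟩ := Finsupp.card_support_eq_one'.1 hcard
      simp only [Finsupp.degree_single] at hd
      subst hd
      refine Submodule.mem_sup_right ?_
      have h : cornerMonomial n (l + 1 + 2) ⟨(p, p), le_rfl⟩ ∈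
          Submodule.span ℤ (Set.range (cornerMonomial n (l + 1 + 2))) :=
        Submodule.subset_span ⟨_, rfl⟩
      convert Submodule.smul_mem _ (2 : ℤ) h using 1
      rw [cornerMonomial, ← X_pow_eq_monomial, ← pow_succ', smul_eq_C_mul]
      rfl
    · obtain ⟨p, q, hpq, hs⟩ := Finset.card_eq_two.1 hcard
      wlog hlt : p < q generalizing p q
      · exact this q p hpq.symm (by rw [hs, Finset.pair_comm]) (by omega)
      have hp : d p ≠ 0 := Finsupp.mem_support_iff.1 (by simp [hs])
      have hq : d q ≠ 0 := Finsupp.mem_support_iff.1 (by simp [hs])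
      rw [Finsupp.degree_apply, hs, Finset.sum_pair hpq] at hd
      have h2 := two_mul_pow_mul_pow_mem hl hlt (d p - 1) (d q - 1) (by omega)
      convert h2 using 2
      rw [monomial_eq, Finsupp.prod, hs, Finset.prod_pair hpq, Nat.sub_add_cancel (by omega),
        Nat.sub_add_cancel (by omega)]
      simp

lemma two_smul_mem {l : ℕ} (hl : Even l) {p : MvPolynomial (Fin n) ℤ}
    (hp : p ∈ homogeneousSubmodule (Fin n) ℤ (l + 1 + 2)) : (2 : ℤ) • p ∈
      traceImage ℤ n (l + 1 + 2) ⊔ Submodule.span ℤ (Set.range (cornerMonomial n (l + 1 + 2))) := by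
  rw [p.as_sum, Finset.smul_sum]
  refine Submodule.sum_mem _ fun d hd => ?_
  have h := two_mul_monomial_mem hl d (by
    rw [Finsupp.degree_eq_weight_one]
    exact hp (mem_support_iff.1 hd))
  convert Submodule.smul_mem _ (coeff d p) h using 1
  rw [smul_eq_C_mul, smul_eq_C_mul, ← mul_one (coeff d p), ← C_mul_monomial, mul_one]
  simp only [map_ofNat]
  ring

lemma traceImage_le (R : Type) [CommRing R] (n k : ℕ) :
    traceImage R n k ≤ homogeneousSubmodule (Fin n) R k := by
  have h : (⊤ : Submodule R (Sym[R]^k (H R n))).map (symToPoly R n k) ≤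
      homogeneousSubmodule (Fin n) R k := by
    rw [← span_symMonomial, Submodule.map_span, Submodule.span_le]
    rintro _ ⟨_, ⟨j, rfl⟩, rfl⟩
    rw [symToPoly_symMonomial]
    exact isHomogeneous_monomial _ (by simp)
  exact (Submodule.map_mono le_top).trans h

/-- The evaluations are triangular on corner monomials: `e_i` detects only `X_i^k`, and once these
are gone `e_i - e_j` with `i < j` detects only `X_i X_j^(k-1)`, with value `±1`. -/
lemma sum_cornerMonomial_eq_zero {l : ℕ}
    {c : {p : Fin n × Fin n // p.1 ≤ p.2} → ℤ}
    (h : ∑ ij, c ij • cornerMonomial n (l + 1 + 2) ij ∈ traceImage ℤ n (l + 1 + 2)) : c = 0 := by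
  have hdiag : ∀ i, c ⟨(i, i), le_rfl⟩ = 0 := fun i => by
    have h2 := eval_single_eq_zero h i
    rw [map_sum, Finset.sum_eq_single ⟨(i, i), le_rfl⟩] at h2
    · simpa [cornerMonomial] using h2
    · rintro ⟨⟨a, b⟩, hab⟩ - hne
      have : ¬ (a = i ∧ b = i) := by
        rintro ⟨rfl, rfl⟩
        exact hne rfl
      by_cases ha : a = i
      · have hb : b ≠ i := fun hb => this ⟨ha, hb⟩
        simp [cornerMonomial, hb]
      · simp [cornerMonomial, ha]
    · simp
  funext ⟨⟨i, j⟩, hij⟩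
  rcases hij.eq_or_lt with h1 | hlt
  · obtain rfl : i = j := h1
    exact hdiag i
  replace hlt : i < j := hlt
  have h2 := eval_single_sub_single_eq_zero h (i := i) (j := j)
  rw [map_sum, Finset.sum_eq_single ⟨(i, j), hij⟩] at h2
  · simpa [cornerMonomial, hlt.ne, hlt.ne'] using h2
  · rintro ⟨⟨a, b⟩, hab⟩ - hne
    rcases eq_or_ne a b with rfl | hne2
    · simp [hdiag]
    replace hab : a < b := lt_of_le_of_ne hab hne2
    by_cases ha : a = i ∨ a = j
    · have hb : b ≠ i ∧ b ≠ j := by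
        constructor
        · rintro rfl
          rcases ha with rfl | rfl <;> omega
        · rintro rfl
          rcases ha with rfl | rfl
          · exact hne rfl
          · omega
      simp [cornerMonomial, hb.1, hb.2]
    · push Not at ha
      simp [cornerMonomial, ha.1, ha.2]
  · simp

lemma finite_homogeneousSubmodule (n k : ℕ) :
    Module.Finite ℤ (homogeneousSubmodule (Fin n) ℤ k) :=
  Module.Finite.of_fg (homogeneousSubmodule_fg (Fin n) ℤ k)

lemma finrank_homogeneousSubmodule (n k : ℕ) :
    Module.finrank ℤ (homogeneousSubmodule (Fin n) ℤ k) = (n + k - 1).choose k := by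
  classical
  let e : Sym (Fin n) k ≃ {d : Fin n →₀ ℕ | d.degree = k} := Sym.equivNatSum (Fin n) k
  let _ : Fintype {d : Fin n →₀ ℕ | d.degree = k} := Fintype.ofEquiv _ e
  rw [homogeneousSubmodule_eq_finsupp_supported,
    (AddMonoidAlgebra.supportedEquivFinsupp {d : Fin n →₀ ℕ | d.degree = k}).finrank_eq,
    Module.finrank_finsupp_self, ← Fintype.card_congr e, Sym.card_sym_eq_choose, Fintype.card_fin]

lemma card_pairs (n : ℕ) :
    Fintype.card {p : Fin n × Fin n // p.1 ≤ p.2} = (n + 1).choose 2 := by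
  rw [← Fintype.card_congr Sym2.sortEquiv, Sym2.card, Fintype.card_fin]

lemma finrank_traceImage {l : ℕ} (hl : Even l) (n : ℕ) :
    Module.finrank ℤ (traceImage ℤ n (l + 1 + 2)) + (n + 1).choose 2 =
      (n + (l + 1 + 2) - 1).choose (l + 1 + 2) := by
  set I := traceImage ℤ n (l + 1 + 2) with hI
  set V := homogeneousSubmodule (Fin n) ℤ (l + 1 + 2) with hV
  have hVf : Module.Finite ℤ V := finite_homogeneousSubmodule _ _
  have hIV : I ≤ V := traceImage_le ℤ n _
  have hIf : Module.Finite ℤ I :=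
    Module.Finite.of_injective _ (Submodule.inclusion_injective hIV)
  let T : (I × ({p : Fin n × Fin n // p.1 ≤ p.2} → ℤ)) →ₗ[ℤ] MvPolynomial (Fin n) ℤ :=
    I.subtype.coprod (Fintype.linearCombination ℤ (cornerMonomial n (l + 1 + 2)))
  have hT : Function.Injective T := by
    rw [← LinearMap.ker_eq_bot, LinearMap.ker_eq_bot']
    rintro ⟨p, c⟩ h
    simp only [T, LinearMap.coprod_apply, Submodule.subtype_apply,
      Fintype.linearCombination_apply] at h
    have hc : c = 0 := sum_cornerMonomial_eq_zero (by
      rw [← neg_eq_iff_add_eq_zero.2 h]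
      exact Submodule.neg_mem _ p.2)
    subst hc
    simpa using h
  have hrange : LinearMap.range T =
      I ⊔ Submodule.span ℤ (Set.range (cornerMonomial n (l + 1 + 2))) := by
    rw [LinearMap.range_coprod, Submodule.range_subtype, Fintype.range_linearCombination]
  have hTV : LinearMap.range T ≤ V := by
    rw [hrange]
    refine sup_le hIV (Submodule.span_le.2 ?_)
    rintro _ ⟨⟨⟨i, j⟩, hij⟩, rfl⟩
    have h := (isHomogeneous_X ℤ i).mul ((isHomogeneous_X ℤ j).pow (l + 1 + 2 - 1))
    have e : 1 + 1 * (l + 1 + 2 - 1) = l + 1 + 2 := by omega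
    rw [e] at h
    exact h
  have hTf : Module.Finite ℤ (LinearMap.range T) :=
    Module.Finite.of_injective _ (Submodule.inclusion_injective hTV)
  have h1 := LinearMap.finrank_range_of_inj hT
  rw [Module.finrank_prod, Module.finrank_fintype_fun_eq_card, card_pairs] at h1
  have h2 := LinearMap.finrank_le_finrank_of_injective (Submodule.inclusion_injective hTV)
  -- Doubling embeds `V` into the range of `T`, so the two have equal rank although the index may be
  -- a nontrivial power of 2.
  let D : V →ₗ[ℤ] LinearMap.range T := ((2 : ℤ) • V.subtype).codRestrict _ fun p => by
    rw [hrange]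
    exact two_smul_mem hl p.2
  have hD : Function.Injective D := fun p q h => by
    have h' := congrArg Subtype.val h
    simpa [D] using h'
  have h3 := LinearMap.finrank_le_finrank_of_injective hD
  rw [← h1, ← finrank_homogeneousSubmodule]
  exact le_antisymm h2 h3

end Count

end SpecialDer

end

theorem theorem6 (n k : ℕ) (hn : 3 ≤ n) (hk : 3 ≤ k) (hodd : Odd k) :
    Module.Free ℤ (LinearMap.range (SpecialDer.moritaTraceSpecial ℤ n k)) ∧
    Module.Finite ℤ (LinearMap.range (SpecialDer.moritaTraceSpecial ℤ n k)) ∧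
    (Module.finrank ℤ (LinearMap.range (SpecialDer.moritaTraceSpecial ℤ n k)) : ℚ) =
      ((n + k - 1).choose k : ℚ) - (n : ℚ) * ((n : ℚ) + 1) / 2 := by
  obtain ⟨l, rfl⟩ : ∃ l, k = l + 1 + 2 := ⟨k - 3, by omega⟩
  have hl : Even l := by
    rw [Nat.odd_iff] at hodd
    rw [Nat.even_iff]
    omega
  have e : LinearMap.range (SpecialDer.moritaTraceSpecial ℤ n (l + 1 + 2)) ≃ₗ[ℤ]
      SpecialDer.traceImage ℤ n (l + 1 + 2) :=
    Submodule.equivMapOfInjective (SpecialDer.symToPoly ℤ n (l + 1 + 2))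
    (SpecialDer.symToPoly_injective (l + 1 + 2))
    (LinearMap.range (SpecialDer.moritaTraceSpecial ℤ n (l + 1 + 2)))
  have hV := SpecialDer.finite_homogeneousSubmodule n (l + 1 + 2)
  have hIf : Module.Finite ℤ (SpecialDer.traceImage ℤ n (l + 1 + 2)) :=
    Module.Finite.of_injective _
      (Submodule.inclusion_injective (SpecialDer.traceImage_le ℤ n (l + 1 + 2)))
  have hIfree : Module.Free ℤ (SpecialDer.traceImage ℤ n (l + 1 + 2)) := inferInstance
  refine ⟨Module.Free.of_equiv e.symm, Module.Finite.equiv e.symm, ?_⟩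
  have h := SpecialDer.finrank_traceImage hl n
  rw [e.finrank_eq, ← h]
  push_cast
  rw [Nat.cast_choose_two]
  push_cast
  ring
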